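/- Let $(M,K,\eta)$ be an almost para-Hermitian manifold: $M$ is a smooth manifold of dimension $2d$, $\eta$ is a smooth pseudo-Riemannian metric on $M$ of signature $(d,d)$, and $K$ is a smooth bundle automorphism of $TM$ covering the identity, with $K^2=1$ and $K\neq\pm1$, whose $\pm1$-eigenbundles $L_\pm$ have equal rank $d$, and which satisfies $\eta(K(X),K(Y))=-\eta(X,Y)$. Let $\nabla^{\mathrm{LC}}$ be the Levi-Civita connection of $\eta$, and let $\mathsf p_\pm=\tfrac12(1\pm K)$ be the projections onto $L_\pm$. The canonical connection is $$\nabla^{\mathrm{can}}=\mathsf p_+\circ\nabla^{\mathrm{LC}}\circ\mathsf p_+ +\mathsf p_-\circ\nabla^{\mathrm{LC}}\circ\mathsf p_-,$$ and the canonical D-bracket of two vector fields $X,Y$ is the vector field $[\![X,Y]\!]_{\mathrm{can}}$ determined by $$\eta([\![X,Y]\!]_{\mathrm{can}},Z)=\eta(\nabla^{\mathrm{can}}_XY-\nabla^{\mathrm{can}}_YX,Z)+\eta(\nabla^{\mathrm{can}}_ZX,Y)$$ for all vector fields $Z$. Let $L_{\mathrm D}\subset TM$ be an almost Born D-brane,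 i.e. a smooth sub-bundle which is maximally isotropic with respect to $\eta$ and satisfies $K(L_{\mathrm D})=L_{\mathrm D}$. Suppose that $L_{\mathrm D}$ is preserved by $\nabla^{\mathrm{LC}}$, i.e. $\nabla^{\mathrm{LC}}_XY\in\Gamma(L_{\mathrm D})$ for every vector field $X$ and every $Y\in\Gamma(L_{\mathrm D})$. Then $L_{\mathrm D}$ is involutive, $[\Gamma(L_{\mathrm D}),\Gamma(L_{\mathrm D})]\subseteq\Gamma(L_{\mathrm D})$, so that it is a Born D-brane, and it is D-integrable, $[\![\Gamma(L_{\mathrm D}),\Gamma(L_{\mathrm D})]\!]_{\mathrm{can}}\subseteq\Gamma(L_{\mathrm D})$. Here $\Gamma$ denotes smooth sections. -/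

import Mathlib

open Bundle VectorField
open scoped Manifold ContDiff

noncomputable section

namespace ParaHermitian

section Metric

/-! ### Pseudo-Riemannian metrics -/

/-- A smooth pseudo-Riemannian metric on a manifold `M`: a smooth family of symmetric
non-degenerate bilinear forms on the tangent spaces. -/
structure PseudoRiemannianMetric {E : Type*} [NormedAddCommGroup E] [NormedSpace ℝ E]
    {H : Type*} [TopologicalSpace H] (I : ModelWithCorners ℝ E H)
    (M : Type*) [TopologicalSpace M] [ChartedSpace H M] [IsManifold I ∞ M] where
  /-- The bilinear form on each tangent space. -/
  val (x : M) : TangentSpace I x →L[ℝ] TangentSpace I x →L[ℝ] ℝ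
  symm (x : M) (v w : TangentSpace I x) : val x v w = val x w v
  nondegenerate (x : M) (v : TangentSpace I x) : (∀ w, val x v w = 0) → v = 0
  contMDiff : ContMDiff I (I.prod 𝓘(ℝ, E →L[ℝ] E →L[ℝ] ℝ)) ∞
    (fun x ↦ TotalSpace.mk' (E →L[ℝ] E →L[ℝ] ℝ)
      (E := fun y : M ↦ TangentSpace I y →L[ℝ] TangentSpace I y →L[ℝ] ℝ) x (val x))

variable {E : Type*} [NormedAddCommGroup E] [NormedSpace ℝ E]
  {H : Type*} [TopologicalSpace H] {I : ModelWithCorners ℝ E H}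
  {M : Type*} [TopologicalSpace M] [ChartedSpace H M] [IsManifold I ∞ M]

namespace PseudoRiemannianMetric

variable (g : PseudoRiemannianMetric I M)

/-- The quadratic form `v ↦ g(v, v)` on the tangent space at `x`. -/
def quadraticForm (x : M) : QuadraticForm ℝ (TangentSpace I x) :=
  LinearMap.BilinMap.toQuadraticMap (ContinuousLinearMap.toLinearMap₁₂ (g.val x))

/-- The metric has signature `(p, q)` at every point. -/
def HasSignature (p q : ℕ) : Prop :=
  ∀ x : M, sigPos (g.quadraticForm x) = p ∧ sigNeg (g.quadraticForm x) = q

lemma mdifferentiableAt_apply {Y Z : Π x : M, TangentSpace I x} {x : M}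
    (hY : MDiffAt (T% Y) x) (hZ : MDiffAt (T% Z) x) :
    MDiffAt (fun y ↦ g.val y (Y y) (Z y)) x := by
  have hg := g.contMDiff.mdifferentiable (by simp) x
  have := MDifferentiableAt.clm_bundle_apply₂ (b := fun y : M ↦ y) (F₁ := E) (F₂ := E)
    (F₃ := ℝ) (E₁ := (TangentSpace I : M → Type _)) (E₂ := (TangentSpace I : M → Type _))
    (E₃ := Bundle.Trivial M ℝ) hg hY hZ
  simp only [mdifferentiableAt_totalSpace] at this
  exact this.2

lemma eq_of_val_eq {x : M} {u v : TangentSpace I x} (h : ∀ w, g.val x u w = g.val x v w) :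
    u = v :=
  sub_eq_zero.1 <| g.nondegenerate x _ fun w ↦ by simp [h w]


/-! ### The Levi-Civita connection

It is constructed from the Koszul formula. The lemmas `torsion_leviCivita` and
`leviCivita_metric` show that the result is torsion-free and compatible with the metric. -/

/-- The right-hand side of the Koszul formula for `g(∇_X Y, Z)` at the point `x`. -/
def koszul (X Y Z : Π x : M, TangentSpace I x) (x : M) : ℝ :=
  (1 / 2) * (d% (fun y ↦ g.val y (Y y) (Z y)) x (X x)
    + d% (fun y ↦ g.val y (Z y) (X y)) x (Y x)
    - d% (fun y ↦ g.val y (X y) (Y y)) x (Z x)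
    + g.val x (mlieBracket I X Y x) (Z x)
    - g.val x (mlieBracket I Y Z x) (X x)
    + g.val x (mlieBracket I Z X x) (Y x))

section derivatives

variable {X X' Y : Π x : M, TangentSpace I x} {f : M → ℝ} {x : M}

lemma mvfderiv_add_left (hX : MDiffAt (T% X) x) (hX' : MDiffAt (T% X') x)
    (hY : MDiffAt (T% Y) x) :
    d% (fun y ↦ g.val y ((X + X') y) (Y y)) x =
      d% (fun y ↦ g.val y (X y) (Y y)) x + d% (fun y ↦ g.val y (X' y) (Y y)) x := by
  simp only [Pi.add_apply, map_add, add_apply]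
  exact mvfderiv_fun_add (g.mdifferentiableAt_apply hX hY) (g.mdifferentiableAt_apply hX' hY)

lemma mvfderiv_add_right (hX : MDiffAt (T% X) x) (hX' : MDiffAt (T% X') x)
    (hY : MDiffAt (T% Y) x) :
    d% (fun y ↦ g.val y (Y y) ((X + X') y)) x =
      d% (fun y ↦ g.val y (Y y) (X y)) x + d% (fun y ↦ g.val y (Y y) (X' y)) x := by
  simp only [Pi.add_apply, map_add]
  exact mvfderiv_fun_add (g.mdifferentiableAt_apply hY hX) (g.mdifferentiableAt_apply hY hX')

lemma mvfderiv_smul_left (hf : MDiffAt f x) (hX : MDiffAt (T% X) x) (hY : MDiffAt (T% Y) x) :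
    d% (fun y ↦ g.val y ((f • X) y) (Y y)) x =
      f x • d% (fun y ↦ g.val y (X y) (Y y)) x + g.val x (X x) (Y x) • d% f x := by
  simp only [Pi.smul_apply', map_smul, smul_apply, smul_eq_mul]
  exact mvfderiv_fun_mul hf (g.mdifferentiableAt_apply hX hY)

lemma mvfderiv_smul_right (hf : MDiffAt f x) (hX : MDiffAt (T% X) x) (hY : MDiffAt (T% Y) x) :
    d% (fun y ↦ g.val y (Y y) ((f • X) y)) x =
      f x • d% (fun y ↦ g.val y (Y y) (X y)) x + g.val x (Y x) (X x) • d% f x := by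
  simp only [Pi.smul_apply', map_smul, smul_eq_mul]
  exact mvfderiv_fun_mul hf (g.mdifferentiableAt_apply hY hX)

end derivatives

lemma koszul_torsion (X Y Z : Π x : M, TangentSpace I x) (x : M) :
    g.koszul X Y Z x - g.koszul Y X Z x = g.val x (mlieBracket I X Y x) (Z x) := by
  have e (U V : Π x : M, TangentSpace I x) :
      (fun y ↦ g.val y (U y) (V y)) = fun y ↦ g.val y (V y) (U y) := by
    ext y; exact g.symm y _ _
  simp only [koszul]
  rw [e Y Z, e Z X, e Y X, mlieBracket_swap_apply (V := Y) (W := X),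
    mlieBracket_swap_apply (V := X) (W := Z), mlieBracket_swap_apply (V := Z) (W := Y)]
  simp only [map_neg, neg_apply]
  ring

lemma koszul_metric (X Y Z : Π x : M, TangentSpace I x) (x : M) :
    g.koszul X Y Z x + g.koszul X Z Y x = d% (fun y ↦ g.val y (Y y) (Z y)) x (X x) := by
  have e (U V : Π x : M, TangentSpace I x) :
      (fun y ↦ g.val y (U y) (V y)) = fun y ↦ g.val y (V y) (U y) := by
    ext y; exact g.symm y _ _
  simp only [koszul]
  rw [e Z Y, e Z X, e Y X, mlieBracket_swap_apply (V := X) (W := Z),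
    mlieBracket_swap_apply (V := Y) (W := X), mlieBracket_swap_apply (V := Z) (W := Y)]
  simp only [map_neg, neg_apply]
  ring

variable [FiniteDimensional ℝ E]

instance (x : M) : FiniteDimensional ℝ (TangentSpace I x) :=
  inferInstanceAs (FiniteDimensional ℝ E)

instance (x : M) : T2Space (TangentSpace I x) := inferInstanceAs (T2Space E)

/-- The musical isomorphism `v ↦ g(v, ·)` from the tangent space to its dual. -/
def flat (x : M) : TangentSpace I x ≃ₗ[ℝ] (TangentSpace I x →L[ℝ] ℝ) :=
  LinearEquiv.ofInjectiveOfFinrankEq (g.val x).toLinearMap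
    ((injective_iff_map_eq_zero _).2 fun v hv ↦
      g.nondegenerate x v fun w ↦ DFunLike.congr_fun hv w)
    (by rw [← (LinearMap.toContinuousLinearMap (𝕜 := ℝ) (E := TangentSpace I x)
          (F' := ℝ)).finrank_eq, Subspace.dual_finrank_eq])

/-- The inverse musical isomorphism: `sharp x φ` is the vector `u` with `g(u, ·) = φ`. -/
def sharp (x : M) : (TangentSpace I x →L[ℝ] ℝ) ≃ₗ[ℝ] TangentSpace I x := (g.flat x).symm

@[simp]
lemma val_sharp (x : M) (φ : TangentSpace I x →L[ℝ] ℝ) (w : TangentSpace I x) :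
    g.val x (g.sharp x φ) w = φ w :=
  DFunLike.congr_fun ((g.flat x).apply_symm_apply φ) w


section tensoriality

variable {X Y Z : Π x : M, TangentSpace I x} {x : M}

lemma koszul_tensorial_left (hY : MDiffAt (T% Y) x) (hZ : MDiffAt (T% Z) x) :
    TensorialAt I E (fun X ↦ g.koszul X Y Z x) x where
  smul {f X} hf hX := by
    simp only [koszul]
    rw [g.mvfderiv_smul_left hf hX hY, g.mvfderiv_smul_right hf hX hZ,
      mlieBracket_smul_left hf hX, mlieBracket_smul_right hf hX]
    simp only [Pi.smul_apply', map_smul, map_add, add_apply,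
      smul_apply, smul_eq_mul, neg_smul, map_neg,
      neg_apply]
    rw [g.symm x (Z x) (X x)]
    ring
  add {X X'} hX hX' := by
    simp only [koszul]
    rw [g.mvfderiv_add_left hX hX' hY, g.mvfderiv_add_right hX hX' hZ,
      mlieBracket_add_left hX hX', mlieBracket_add_right hX hX']
    simp only [Pi.add_apply, map_add, add_apply]
    ring

lemma koszul_tensorial_right (hX : MDiffAt (T% X) x) (hY : MDiffAt (T% Y) x) :
    TensorialAt I E (fun Z ↦ g.koszul X Y Z x) x where
  smul {f Z} hf hZ := by
    simp only [koszul]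
    rw [g.mvfderiv_smul_left hf hZ hX, g.mvfderiv_smul_right hf hZ hY,
      mlieBracket_smul_left hf hZ, mlieBracket_smul_right hf hZ]
    simp only [Pi.smul_apply', map_smul, map_add, add_apply,
      smul_apply, smul_eq_mul, neg_smul, map_neg,
      neg_apply]
    rw [g.symm x (Z x) (X x), g.symm x (Z x) (Y x)]
    ring
  add {Z Z'} hZ hZ' := by
    simp only [koszul]
    rw [g.mvfderiv_add_left hZ hZ' hX, g.mvfderiv_add_right hZ hZ' hY,
      mlieBracket_add_left hZ hZ', mlieBracket_add_right hZ hZ']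
    simp only [Pi.add_apply, map_add, add_apply]
    ring

lemma koszul_add {Y' : Π x : M, TangentSpace I x} (hX : MDiffAt (T% X) x)
    (hY : MDiffAt (T% Y) x) (hY' : MDiffAt (T% Y') x) (hZ : MDiffAt (T% Z) x) :
    g.koszul X (Y + Y') Z x = g.koszul X Y Z x + g.koszul X Y' Z x := by
  simp only [koszul]
  rw [g.mvfderiv_add_left hY hY' hZ, g.mvfderiv_add_right hY hY' hX,
    mlieBracket_add_left hY hY', mlieBracket_add_right hY hY']
  simp only [Pi.add_apply, map_add, add_apply]
  ring

lemma koszul_leibniz {f : M → ℝ} (hX : MDiffAt (T% X) x)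
    (hf : MDiffAt f x) (hY : MDiffAt (T% Y) x) (hZ : MDiffAt (T% Z) x) :
    g.koszul X (f • Y) Z x = f x * g.koszul X Y Z x + d% f x (X x) * g.val x (Y x) (Z x) := by
  simp only [koszul]
  rw [g.mvfderiv_smul_left hf hY hZ, g.mvfderiv_smul_right hf hY hX,
    mlieBracket_smul_left hf hY, mlieBracket_smul_right hf hY]
  simp only [Pi.smul_apply', map_smul, map_add, add_apply,
    smul_apply, smul_eq_mul, neg_smul, map_neg,
    neg_apply]
  rw [g.symm x (X x) (Y x)]
  ring

end tensoriality

open Classical in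
/-- The underlying function of the Levi-Civita connection: for `Y` differentiable at `x`, the
vector `leviCivitaFun Y x v` is determined by the Koszul formula (extending `v` to a vector field
near `x`). As everywhere in the library, `leviCivitaFun Y x (X x)` is `(∇_X Y)(x)`. The value on
vector fields which are not differentiable is irrelevant. -/
def leviCivitaFun (Y : Π x : M, TangentSpace I x) (x : M) :
    TangentSpace I x →L[ℝ] TangentSpace I x :=
  if hY : MDiffAt (T% Y) x then
    LinearMap.toContinuousLinearMap ((g.sharp x).toLinearMap ∘ₗ
      (TensorialAt.mkHom₂ (fun X Z ↦ g.koszul X Y Z x) x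
        (fun _ hZ ↦ g.koszul_tensorial_left hY hZ)
        (fun _ hX ↦ g.koszul_tensorial_right hX hY)).toLinearMap)
  else 0

lemma val_leviCivitaFun {X Y Z : Π x : M, TangentSpace I x} {x : M}
    (hX : MDiffAt (T% X) x) (hY : MDiffAt (T% Y) x) (hZ : MDiffAt (T% Z) x) :
    g.val x (g.leviCivitaFun Y x (X x)) (Z x) = g.koszul X Y Z x := by
  rw [leviCivitaFun, dif_pos hY]
  refine (g.val_sharp x _ _).trans ?_
  exact TensorialAt.mkHom₂_apply _ _ hX hZ

/-- The Levi-Civita connection of a pseudo-Riemannian metric. -/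
def leviCivita : CovariantDerivative I E (TangentSpace I : M → Type _) where
  toFun := g.leviCivitaFun
  isCovariantDerivativeOnUniv :=
    { add := fun {Y Y' x} hY hY' _ ↦ by
        ext v
        refine g.eq_of_val_eq fun w ↦ ?_
        have hv : MDiffAt (T% (FiberBundle.extend E v)) x :=
          FiberBundle.mdifferentiableAt_extend I E v
        have hw : MDiffAt (T% (FiberBundle.extend E w)) x :=
          FiberBundle.mdifferentiableAt_extend I E w
        have h1 := g.val_leviCivitaFun hv (mdifferentiableAt_add_section hY hY') hw
        have h2 := g.val_leviCivitaFun hv hY hw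
        have h3 := g.val_leviCivitaFun hv hY' hw
        rw [g.koszul_add hv hY hY' hw, ← h2, ← h3] at h1
        simpa using h1
      leibniz := fun {Y f x} hY hf _ ↦ by
        ext v
        refine g.eq_of_val_eq fun w ↦ ?_
        have hv : MDiffAt (T% (FiberBundle.extend E v)) x :=
          FiberBundle.mdifferentiableAt_extend I E v
        have hw : MDiffAt (T% (FiberBundle.extend E w)) x :=
          FiberBundle.mdifferentiableAt_extend I E w
        have h1 := g.val_leviCivitaFun hv (hf.smul_section hY) hw
        have h2 := g.val_leviCivitaFun hv hY hw
        rw [g.koszul_leibniz hv hf hY hw, ← h2] at h1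
        simpa using h1 }

lemma val_leviCivita {X Y Z : Π x : M, TangentSpace I x} {x : M}
    (hX : MDiffAt (T% X) x) (hY : MDiffAt (T% Y) x) (hZ : MDiffAt (T% Z) x) :
    g.val x (g.leviCivita Y x (X x)) (Z x) = g.koszul X Y Z x :=
  g.val_leviCivitaFun hX hY hZ

/-- The Levi-Civita connection is torsion-free. -/
lemma torsion_leviCivita : g.leviCivita.torsion = 0 := by
  refine (CovariantDerivative.torsion_eq_zero_iff _).2 fun {X Y x} hX hY ↦ ?_
  refine g.eq_of_val_eq fun w ↦ ?_
  have hw : MDiffAt (T% (FiberBundle.extend E w)) x := FiberBundle.mdifferentiableAt_extend I E w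
  have h := g.koszul_torsion X Y (FiberBundle.extend E w) x
  rw [← g.val_leviCivita hX hY hw, ← g.val_leviCivita hY hX hw] at h
  simpa using h

/-- The Levi-Civita connection is compatible with the metric:
`X (g(Y, Z)) = g(∇_X Y, Z) + g(Y, ∇_X Z)`. -/
lemma leviCivita_metric {X Y Z : Π x : M, TangentSpace I x} {x : M}
    (hX : MDiffAt (T% X) x) (hY : MDiffAt (T% Y) x) (hZ : MDiffAt (T% Z) x) :
    d% (fun y ↦ g.val y (Y y) (Z y)) x (X x) =
      g.val x (g.leviCivita Y x (X x)) (Z x) + g.val x (Y x) (g.leviCivita Z x (X x)) := by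
  rw [g.symm x (Y x), g.val_leviCivita hX hY hZ, g.val_leviCivita hX hZ hY,
    g.koszul_metric X Y Z x]


/-! ### The D-bracket of a connection -/

/-- The D-bracket on vector fields induced by a metric `g` and a connection `∇`, determined by
`g(⟦X, Y⟧, Z) = g(∇_X Y - ∇_Y X, Z) + g(∇_Z X, Y)` for all `Z`. -/
def dBracket (cov : CovariantDerivative I E (TangentSpace I : M → Type _))
    (X Y : Π x : M, TangentSpace I x) (x : M) : TangentSpace I x :=
  g.sharp x (g.val x (cov Y x (X x) - cov X x (Y x)) + g.val x (Y x) ∘L cov X x)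

lemma val_dBracket (cov : CovariantDerivative I E (TangentSpace I : M → Type _))
    (X Y Z : Π x : M, TangentSpace I x) (x : M) :
    g.val x (g.dBracket cov X Y x) (Z x) =
      g.val x (cov Y x (X x) - cov X x (Y x)) (Z x) + g.val x (cov X x (Z x)) (Y x) := by
  simp [dBracket, g.symm x (Y x)]

end PseudoRiemannianMetric
end Metric

section Distributions

/-! ### Distributions -/

variable {E : Type*} [NormedAddCommGroup E] [NormedSpace ℝ E]
  {H : Type*} [TopologicalSpace H] {I : ModelWithCorners ℝ E H}
  {M : Type*} [TopologicalSpace M] [ChartedSpace H M] [IsManifold I ∞ M]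

/-- The family of subspaces `L` of the tangent spaces is a smooth sub-bundle of the tangent bundle:
locally it is spanned by linearly independent smooth vector fields. -/
def IsSmoothSubbundle (L : ∀ x : M, Submodule ℝ (TangentSpace I x)) : Prop :=
  ∀ x : M, ∃ U : Set M, IsOpen U ∧ x ∈ U ∧
    ∃ (k : ℕ) (s : Fin k → Π y : M, TangentSpace I y),
      (∀ i, CMDiff[U] ∞ (T% (s i))) ∧
      ∀ y ∈ U, LinearIndependent ℝ (fun i ↦ s i y) ∧
        Submodule.span ℝ (Set.range fun i ↦ s i y) = L y

/-- `X ∈ Γ(L)`: the vector field `X` is smooth and takes values in `L`. -/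
def IsSection (L : ∀ x : M, Submodule ℝ (TangentSpace I x)) (X : Π x : M, TangentSpace I x) :
    Prop :=
  CMDiff ∞ (T% X) ∧ ∀ x, X x ∈ L x

/-- `L` is involutive: `[Γ(L), Γ(L)] ⊆ Γ(L)` for the Lie bracket of vector fields. -/
def IsInvolutive (L : ∀ x : M, Submodule ℝ (TangentSpace I x)) : Prop :=
  ∀ X Y : Π x : M, TangentSpace I x, IsSection L X → IsSection L Y →
    IsSection L (mlieBracket I X Y)

/-- `L` is preserved by the connection `∇`: for every smooth vector field `X` and every
`Y ∈ Γ(L)`, the vector field `∇_X Y` takes values in `L`. -/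
def IsPreservedBy (cov : CovariantDerivative I E (TangentSpace I : M → Type _))
    (L : ∀ x : M, Submodule ℝ (TangentSpace I x)) : Prop :=
  ∀ X Y : Π x : M, TangentSpace I x, CMDiff ∞ (T% X) → IsSection L Y →
    ∀ x, cov Y x (X x) ∈ L x

end Distributions

section ParaHermitian

/-! ### Almost para-Hermitian manifolds -/

/-- An almost para-Hermitian structure `(K, η)` on a manifold `M` of dimension `2d`: a pseudo-
Riemannian metric `η` of signature `(d, d)` and a bundle automorphism `K` of `TM` with `K² = 1` and
`K ≠ ± 1`, whose `± 1`-eigenbundles have rank `d`, such that `η(K v, K w) = - η(v, w)`. -/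
structure AlmostParaHermitian {E : Type*} [NormedAddCommGroup E] [NormedSpace ℝ E]
    {H : Type*} [TopologicalSpace H] (I : ModelWithCorners ℝ E H)
    (M : Type*) [TopologicalSpace M] [ChartedSpace H M] [IsManifold I ∞ M] (d : ℕ) where
  /-- The metric. -/
  η : PseudoRiemannianMetric I M
  hasSignature : η.HasSignature d d
  /-- The almost para-complex structure. -/
  K (x : M) : TangentSpace I x →L[ℝ] TangentSpace I x
  contMDiff_K : ContMDiff I (I.prod 𝓘(ℝ, E →L[ℝ] E)) ∞
    (fun x ↦ TotalSpace.mk' (E →L[ℝ] E)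
      (E := fun y : M ↦ TangentSpace I y →L[ℝ] TangentSpace I y) x (K x))
  K_K (x : M) (v : TangentSpace I x) : K x (K x v) = v
  K_ne_one : ¬ ∀ (x : M) (v : TangentSpace I x), K x v = v
  K_ne_neg_one : ¬ ∀ (x : M) (v : TangentSpace I x), K x v = -v
  finrank_plus (x : M) :
    Module.finrank ℝ (Module.End.eigenspace (K x : TangentSpace I x →ₗ[ℝ] TangentSpace I x) 1) = d
  finrank_minus (x : M) :
    Module.finrank ℝ
      (Module.End.eigenspace (K x : TangentSpace I x →ₗ[ℝ] TangentSpace I x) (-1)) = d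
  compatible (x : M) (v w : TangentSpace I x) : η.val x (K x v) (K x w) = -η.val x v w

variable {E : Type*} [NormedAddCommGroup E] [NormedSpace ℝ E]
  {H : Type*} [TopologicalSpace H] {I : ModelWithCorners ℝ E H}
  {M : Type*} [TopologicalSpace M] [ChartedSpace H M] [IsManifold I ∞ M] {d : ℕ}

namespace AlmostParaHermitian

variable (P : AlmostParaHermitian I M d)

/-- The projection `p₊ = (1 + K) / 2` of the tangent space onto the `+1`-eigenspace of `K` along
the `-1`-eigenspace. -/
def projPlus (x : M) : TangentSpace I x →L[ℝ] TangentSpace I x :=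
  (1 / 2 : ℝ) • (ContinuousLinearMap.id ℝ (TangentSpace I x) + P.K x)

/-- The projection `p₋ = (1 - K) / 2` of the tangent space onto the `-1`-eigenspace of `K` along
the `+1`-eigenspace. -/
def projMinus (x : M) : TangentSpace I x →L[ℝ] TangentSpace I x :=
  (1 / 2 : ℝ) • (ContinuousLinearMap.id ℝ (TangentSpace I x) - P.K x)

lemma projPlus_apply (x : M) (v : TangentSpace I x) :
    P.projPlus x v = (1 / 2 : ℝ) • (v + P.K x v) := rfl

lemma projMinus_apply (x : M) (v : TangentSpace I x) :
    P.projMinus x v = (1 / 2 : ℝ) • (v - P.K x v) := rfl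

lemma projPlus_projPlus_add_projMinus_projMinus (x : M) (v : TangentSpace I x) :
    P.projPlus x (P.projPlus x v) + P.projMinus x (P.projMinus x v) = v := by
  simp only [projPlus_apply, projMinus_apply, map_smul, map_add, map_sub, P.K_K]
  module

lemma mdifferentiableAt_K {Y : Π x : M, TangentSpace I x} {x : M} (hY : MDiffAt (T% Y) x) :
    MDiffAt (T% (fun y ↦ P.K y (Y y))) x :=
  MDifferentiableAt.clm_bundle_apply (b := fun y : M ↦ y) (F₁ := E) (F₂ := E)
    (E₁ := (TangentSpace I : M → Type _)) (E₂ := (TangentSpace I : M → Type _))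
    (P.contMDiff_K.mdifferentiable (by simp) x) hY

lemma mdifferentiableAt_projPlus {Y : Π x : M, TangentSpace I x} {x : M}
    (hY : MDiffAt (T% Y) x) : MDiffAt (T% (fun y ↦ P.projPlus y (Y y))) x :=
  (mdifferentiableAt_add_section hY (P.mdifferentiableAt_K hY)).smul_const_section (a := 1 / 2)

lemma mdifferentiableAt_projMinus {Y : Π x : M, TangentSpace I x} {x : M}
    (hY : MDiffAt (T% Y) x) : MDiffAt (T% (fun y ↦ P.projMinus y (Y y))) x :=
  (mdifferentiableAt_sub_section hY (P.mdifferentiableAt_K hY)).smul_const_section (a := 1 / 2)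

variable [FiniteDimensional ℝ E]

/-- The canonical connection `∇^can = p₊ ∘ ∇^LC ∘ p₊ + p₋ ∘ ∇^LC ∘ p₋`. -/
def canonicalConnection : CovariantDerivative I E (TangentSpace I : M → Type _) where
  toFun Y x :=
    P.projPlus x ∘L P.η.leviCivita (fun y ↦ P.projPlus y (Y y)) x +
      P.projMinus x ∘L P.η.leviCivita (fun y ↦ P.projMinus y (Y y)) x
  isCovariantDerivativeOnUniv :=
    { add := fun {Y Y' x} hY hY' _ ↦ by
        have h1 := P.η.leviCivita.isCovariantDerivativeOnUniv.add
          (P.mdifferentiableAt_projPlus hY) (P.mdifferentiableAt_projPlus hY')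
        have h2 := P.η.leviCivita.isCovariantDerivativeOnUniv.add
          (P.mdifferentiableAt_projMinus hY) (P.mdifferentiableAt_projMinus hY')
        have e1 : (fun y ↦ P.projPlus y ((Y + Y') y)) =
            (fun y ↦ P.projPlus y (Y y)) + fun y ↦ P.projPlus y (Y' y) := by
          ext y; simp
        have e2 : (fun y ↦ P.projMinus y ((Y + Y') y)) =
            (fun y ↦ P.projMinus y (Y y)) + fun y ↦ P.projMinus y (Y' y) := by
          ext y; simp
        rw [e1, e2, h1, h2]
        ext v
        simp only [add_apply, ContinuousLinearMap.comp_apply, map_add]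
        abel
      leibniz := fun {Y f x} hY hf _ ↦ by
        have h1 := P.η.leviCivita.isCovariantDerivativeOnUniv.leibniz
          (P.mdifferentiableAt_projPlus hY) hf
        have h2 := P.η.leviCivita.isCovariantDerivativeOnUniv.leibniz
          (P.mdifferentiableAt_projMinus hY) hf
        have e1 : (fun y ↦ P.projPlus y ((f • Y) y)) =
            f • fun y ↦ P.projPlus y (Y y) := by
          ext y; simp
        have e2 : (fun y ↦ P.projMinus y ((f • Y) y)) =
            f • fun y ↦ P.projMinus y (Y y) := by
          ext y; simp
        rw [e1, e2, h1, h2]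
        ext v
        have h := P.projPlus_projPlus_add_projMinus_projMinus x (Y x)
        simp only [add_apply, smul_apply, ContinuousLinearMap.comp_apply, map_add, map_smul,
          ContinuousLinearMap.smulRight_apply]
        conv_rhs => rw [← h]
        simp only [smul_add]
        abel }

/-- The canonical D-bracket `⟦·, ·⟧_can`, the D-bracket of the canonical connection. -/
def canonicalBracket (X Y : Π x : M, TangentSpace I x) : Π x : M, TangentSpace I x :=
  P.η.dBracket P.canonicalConnection X Y

/-- `L` is closed under the canonical D-bracket: `⟦Γ(L), Γ(L)⟧_can ⊆ Γ(L)`. -/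
def IsDIntegrable (L : ∀ x : M, Submodule ℝ (TangentSpace I x)) : Prop :=
  ∀ X Y : Π x : M, TangentSpace I x, IsSection L X → IsSection L Y →
    IsSection L (P.canonicalBracket X Y)

end AlmostParaHermitian

namespace AlmostParaHermitian

variable (P : AlmostParaHermitian I M d)

/-- The subspace `W` of the tangent space at `x` is isotropic with respect to `η`. -/
def IsIsotropic (x : M) (W : Submodule ℝ (TangentSpace I x)) : Prop :=
  ∀ v ∈ W, ∀ w ∈ W, P.η.val x v w = 0

/-- An almost Born D-brane: a distribution which is maximally isotropic with respect to `η` and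
preserved by `K`, that is `K(L) = L`. -/
structure IsAlmostBornDBrane (L : ∀ x : M, Submodule ℝ (TangentSpace I x)) : Prop where
  smooth : IsSmoothSubbundle L
  maximal (x : M) : Maximal (P.IsIsotropic x) (L x)
  map_K (x : M) : (L x).map (P.K x : TangentSpace I x →ₗ[ℝ] TangentSpace I x) = L x

/-- A Born D-brane: an involutive almost Born D-brane. -/
structure IsBornDBrane (L : ∀ x : M, Submodule ℝ (TangentSpace I x)) : Prop
    extends P.IsAlmostBornDBrane L where
  involutive : IsInvolutive L

end AlmostParaHermitian

end ParaHermitian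

end ParaHermitian

end

/-!
The Levi-Civita connection `∇` is torsion-free, so for sections `X`, `Y` of a distribution `L`
which it preserves, `[X, Y] = ∇_X Y - ∇_Y X` lies in `L`; hence `L` is involutive.

Since `K(L) = L`, the projections `p₊` and `p₋` preserve `L`, hence so does the canonical
connection. In the formula
`η(⟦X, Y⟧, Z) = η(∇ᶜ_X Y - ∇ᶜ_Y X, Z) + η(∇ᶜ_Z X, Y)` the last term then vanishes for every `Z`,
because `∇ᶜ_Z X` and `Y` both lie in the isotropic subbundle `L`. By non-degeneracy
`⟦X, Y⟧ = ∇ᶜ_X Y - ∇ᶜ_Y X` (`IsAlmostBornDBrane.canonicalBracket_eq`), which lies in `L`.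

What remains is the smoothness of `∇ᶜ_X Y`, which reduces to that of `∇_X Y`
(`PseudoRiemannianMetric.contMDiff_leviCivita`). The Koszul formula shows that `η(∇_X Y, Z)` is
smooth for all smooth `Z`; inverting the Gram matrix of a local frame by Cramer's rule, one finds
that a vector field whose pairings with all smooth vector fields are smooth is itself smooth
(`PseudoRiemannianMetric.contMDiff_of_val`). Bump functions allow one to work with globally defined
smooth vector fields throughout.
-/

open Filter Topology

namespace ParaHermitian

/-! ### Smoothness of the Levi-Civita connection -/

lemma contMDiffAt_det {E : Type*} [NormedAddCommGroup E] [NormedSpace ℝ E]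
    {H : Type*} [TopologicalSpace H] {I : ModelWithCorners ℝ E H}
    {M : Type*} [TopologicalSpace M] [ChartedSpace H M] {n : ℕ∞ω}
    {ι : Type*} [Fintype ι] [DecidableEq ι]
    {A : M → Matrix ι ι ℝ} {x : M}
    (hA : ∀ i j, CMDiffAt n (fun y ↦ A y i j) x) :
    CMDiffAt n (fun y ↦ (A y).det) x := by
  simp only [Matrix.det_apply']
  exact contMDiffAt_finsetSum fun σ _ ↦
    contMDiffAt_const.mul (contMDiffAt_finsetProd fun i _ ↦ hA _ _)

section SmoothFields

variable {E : Type*} [NormedAddCommGroup E] [NormedSpace ℝ E]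
  {H : Type*} [TopologicalSpace H] {I : ModelWithCorners ℝ E H}
  {M : Type*} [TopologicalSpace M] [ChartedSpace H M] [IsManifold I ∞ M]

lemma contMDiff_mvfderiv_apply {f : M → ℝ} {X : Π x : M, TangentSpace I x}
    (hf : CMDiff ∞ f) (hX : CMDiff ∞ (T% X)) :
    CMDiff ∞ (fun x ↦ d% f x (X x)) := by
  -- `X(f)` is the fibre component of `tangentMap f ∘ X`.
  have h := (hf.contMDiff_tangentMap (m := ∞) (by simp)).comp hX
  have h2 : ContMDiff I 𝓘(ℝ, ℝ) ∞ (fun x ↦ (tangentMap I 𝓘(ℝ, ℝ) f ⟨x, X x⟩).2) := by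
    intro x
    have := h x
    rw [contMDiffAt_totalSpace] at this
    simpa using this.2
  exact h2

lemma contMDiff_mlieBracket [CompleteSpace E] {X Y : Π x : M, TangentSpace I x}
    (hX : CMDiff ∞ (T% X)) (hY : CMDiff ∞ (T% Y)) :
    CMDiff ∞ (T% (mlieBracket I X Y)) := by
  have : IsManifold I (((⊤ : ℕ∞) : ℕ∞ω) + 1) M := by simpa using ‹IsManifold I ∞ M›
  have : IsManifold I (minSmoothness ℝ 2) M :=
    IsManifold.of_le (n := ∞) (by simpa using ENat.LEInfty.out)
  exact ContDiff.mlieBracket_vectorField (m := ⊤) (n := ⊤) hX hY (by simp)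

lemma PseudoRiemannianMetric.contMDiff_apply (g : PseudoRiemannianMetric I M)
    {Y Z : Π x : M, TangentSpace I x} (hY : CMDiff ∞ (T% Y)) (hZ : CMDiff ∞ (T% Z)) :
    CMDiff ∞ (fun y ↦ g.val y (Y y) (Z y)) := by
  intro x
  have := ContMDiffAt.clm_bundle_apply₂ (b := fun y : M ↦ y) (F₁ := E) (F₂ := E)
    (F₃ := ℝ) (E₁ := (TangentSpace I : M → Type _)) (E₂ := (TangentSpace I : M → Type _))
    (E₃ := Bundle.Trivial M ℝ) (g.contMDiff x) (hY x) (hZ x)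
  rw [contMDiffAt_totalSpace] at this
  exact this.2

lemma PseudoRiemannianMetric.contMDiff_koszul [CompleteSpace E] (g : PseudoRiemannianMetric I M)
    {X Y Z : Π x : M, TangentSpace I x} (hX : CMDiff ∞ (T% X)) (hY : CMDiff ∞ (T% Y))
    (hZ : CMDiff ∞ (T% Z)) : CMDiff ∞ (g.koszul X Y Z) := by
  have h₁ := contMDiff_mvfderiv_apply (g.contMDiff_apply hY hZ) hX
  have h₂ := contMDiff_mvfderiv_apply (g.contMDiff_apply hZ hX) hY
  have h₃ := contMDiff_mvfderiv_apply (g.contMDiff_apply hX hY) hZ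
  have h₄ := g.contMDiff_apply (contMDiff_mlieBracket hX hY) hZ
  have h₅ := g.contMDiff_apply (contMDiff_mlieBracket hY hZ) hX
  have h₆ := g.contMDiff_apply (contMDiff_mlieBracket hZ hX) hY
  exact contMDiff_const.mul (((((h₁.add h₂).sub h₃).add h₄).sub h₅).add h₆)

variable [FiniteDimensional ℝ E] [T2Space M]

/-- A vector field which is smooth near a point agrees near that point with a globally smooth
one. -/
lemma exists_contMDiff_eventuallyEq {s : Π x : M, TangentSpace I x} {u : Set M} {x₀ : M}
    (hu : u ∈ 𝓝 x₀) (hs : CMDiff[u] ∞ (T% s)) :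
    ∃ Z : Π x : M, TangentSpace I x, CMDiff ∞ (T% Z) ∧ ∀ᶠ y in 𝓝 x₀, Z y = s y := by
  obtain ⟨ρ, -, hρ⟩ :=
    (SmoothBumpFunction.nhds_basis_tsupport (I := I) x₀).mem_iff.1 (interior_mem_nhds.2 hu)
  refine ⟨(ρ : M → ℝ) • s, ?_, ?_⟩
  · exact ContMDiffOn.smul_section_of_tsupport ρ.contMDiff.contMDiffOn isOpen_interior hρ
      (hs.mono interior_subset)
  · filter_upwards [ρ.eventuallyEq_one] with y hy
    simp [hy]

lemma exists_contMDiff_eq {x : M} (v : TangentSpace I x) :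
    ∃ Z : Π x : M, TangentSpace I x, CMDiff ∞ (T% Z) ∧ Z x = v := by
  obtain ⟨u, hu, hs⟩ := FiberBundle.exists_contMDiffOn_extend (k := ∞) I E v
  obtain ⟨Z, hZ, hZv⟩ := exists_contMDiff_eventuallyEq hu hs
  exact ⟨Z, hZ, by simpa using hZv.self_of_nhds⟩

/-- Near every point some globally smooth vector fields form a frame of the tangent bundle. -/
lemma exists_contMDiff_frame (x₀ : M) :
    ∃ s : Fin (Module.finrank ℝ E) → Π x : M, TangentSpace I x, (∀ i, CMDiff ∞ (T% (s i))) ∧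
      ∀ᶠ y in 𝓝 x₀, ∃ b : Module.Basis (Fin (Module.finrank ℝ E)) ℝ (TangentSpace I y),
        ∀ i, b i = s i y := by
  let e := trivializationAt E (TangentSpace I : M → Type _) x₀
  let b := Module.finBasis ℝ E
  have he : e.baseSet ∈ 𝓝 x₀ :=
    e.open_baseSet.mem_nhds (FiberBundle.mem_baseSet_trivializationAt' x₀)
  choose s hs hse using fun i ↦ exists_contMDiff_eventuallyEq he
    (e.contMDiffOn_localFrame_baseSet (I := I) ∞ b i)
  refine ⟨s, hs, ?_⟩
  filter_upwards [he, eventually_all.2 hse] with y hy hys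
  exact ⟨e.basisAt b hy, fun i ↦ by rw [hys i, e.localFrame_apply_of_mem_baseSet b hy]⟩

/-- A vector field is smooth as soon as its pairings with all smooth vector fields are smooth: its
components in a local frame are given by Cramer's rule for the Gram matrix of the frame. -/
lemma PseudoRiemannianMetric.contMDiff_of_val (g : PseudoRiemannianMetric I M)
    {u : Π x : M, TangentSpace I x}
    (hu : ∀ Z : Π x : M, TangentSpace I x, CMDiff ∞ (T% Z) →
      CMDiff ∞ (fun y ↦ g.val y (u y) (Z y))) :
    CMDiff ∞ (T% u) := by
  intro x₀
  obtain ⟨s, hs, hb⟩ := exists_contMDiff_frame (I := I) x₀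
  let A : M → Matrix _ _ ℝ := fun y ↦ Matrix.of fun i j ↦ g.val y (s j y) (s i y)
  let k : M → _ → ℝ := fun y i ↦ g.val y (u y) (s i y)
  have hA (i j) : CMDiffAt ∞ (fun y ↦ A y i j) x₀ := g.contMDiff_apply (hs j) (hs i) x₀
  have hk (i) : CMDiffAt ∞ (fun y ↦ k y i) x₀ := hu _ (hs i) x₀
  have hdet (y : M) (hy : ∃ b : Module.Basis (Fin (Module.finrank ℝ E)) ℝ (TangentSpace I y),
      ∀ i, b i = s i y) : (A y).det ≠ 0 := by
    obtain ⟨b, hb⟩ := hy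
    intro h0
    -- A vector in the kernel of the Gram matrix gives a tangent vector orthogonal to the frame.
    obtain ⟨c, hc, hAc⟩ := Matrix.exists_mulVec_eq_zero_iff.2 h0
    refine hc ?_
    have hzero : ∑ j, c j • b j = 0 := by
      refine g.nondegenerate y _ fun w ↦ ?_
      have : g.val y (∑ j, c j • b j) = 0 := by
        refine ContinuousLinearMap.coe_injective (b.ext fun i ↦ ?_)
        have := congrFun hAc i
        simpa [A, Matrix.mulVec, dotProduct, hb, mul_comm] using this
      simp [this]
    exact funext fun j ↦ Fintype.linearIndependent_iff.1 b.linearIndependent c hzero j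
  have hcoeff (i) : CMDiffAt ∞ (fun y ↦ ((A y).det)⁻¹ * (A y).cramer (k y) i) x₀ := by
    refine (ContMDiffAt.inv₀ (contMDiffAt_det hA) (hdet x₀ hb.self_of_nhds)).mul ?_
    simp only [Matrix.cramer_apply]
    refine contMDiffAt_det fun i' j ↦ ?_
    by_cases h : j = i
    · subst h; simpa using hk i'
    · simpa [Matrix.updateCol_apply, h] using hA i' j
  have hsum : CMDiffAt ∞
      (T% (fun y ↦ ∑ i, (((A y).det)⁻¹ * (A y).cramer (k y) i) • s i y)) x₀ :=
    ContMDiffAt.sum_section fun i _ ↦ (hcoeff i).smul_section (hs i x₀)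
  refine hsum.congr_of_eventuallyEq ?_
  filter_upwards [hb] with y hy
  have hd := hdet y hy
  obtain ⟨b, hb⟩ := hy
  have hkA : k y = (A y).mulVec (b.repr (u y)) := by
    ext i
    conv_lhs => simp only [k]; rw [← b.sum_repr (u y)]
    simp [A, Matrix.mulVec, dotProduct, hb, mul_comm]
  have hu' : u y = ∑ i, (((A y).det)⁻¹ * (A y).cramer (k y) i) • s i y := by
    rw [hkA, Matrix.cramer_eq_adjugate_mulVec, Matrix.mulVec_mulVec, Matrix.adjugate_mul,
      Matrix.smul_mulVec, Matrix.one_mulVec]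
    conv_lhs => rw [← b.sum_repr (u y)]
    simp [hb, hd]
  simp [hu']

lemma PseudoRiemannianMetric.contMDiff_leviCivita (g : PseudoRiemannianMetric I M)
    {X Y : Π x : M, TangentSpace I x} (hX : CMDiff ∞ (T% X)) (hY : CMDiff ∞ (T% Y)) :
    CMDiff ∞ (T% (fun x ↦ g.leviCivita Y x (X x))) := by
  refine g.contMDiff_of_val fun Z hZ ↦ ?_
  have h := g.contMDiff_koszul hX hY hZ
  refine h.congr fun x ↦ ?_
  exact g.val_leviCivita (hX.mdifferentiable (by simp) x) (hY.mdifferentiable (by simp) x)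
    (hZ.mdifferentiable (by simp) x)

end SmoothFields

/-! ### The canonical connection and the canonical bracket on a D-brane -/

namespace AlmostParaHermitian

variable {E : Type*} [NormedAddCommGroup E] [NormedSpace ℝ E]
  {H : Type*} [TopologicalSpace H] {I : ModelWithCorners ℝ E H}
  {M : Type*} [TopologicalSpace M] [ChartedSpace H M] [IsManifold I ∞ M] {d : ℕ}
  (P : AlmostParaHermitian I M d)

lemma contMDiff_K_apply {Y : Π x : M, TangentSpace I x} (hY : CMDiff ∞ (T% Y)) :
    CMDiff ∞ (T% (fun y ↦ P.K y (Y y))) :=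
  ContMDiff.clm_bundle_apply (b := fun y : M ↦ y) (F₁ := E) (F₂ := E)
    (E₁ := (TangentSpace I : M → Type _)) (E₂ := (TangentSpace I : M → Type _))
    P.contMDiff_K hY

lemma contMDiff_projPlus {Y : Π x : M, TangentSpace I x} (hY : CMDiff ∞ (T% Y)) :
    CMDiff ∞ (T% (fun y ↦ P.projPlus y (Y y))) :=
  (hY.add_section (P.contMDiff_K_apply hY)).const_smul_section (a := (1 / 2 : ℝ))

lemma contMDiff_projMinus {Y : Π x : M, TangentSpace I x} (hY : CMDiff ∞ (T% Y)) :
    CMDiff ∞ (T% (fun y ↦ P.projMinus y (Y y))) :=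
  (hY.sub_section (P.contMDiff_K_apply hY)).const_smul_section (a := (1 / 2 : ℝ))

variable {P} {L : ∀ x : M, Submodule ℝ (TangentSpace I x)}

lemma IsAlmostBornDBrane.K_mem (hL : P.IsAlmostBornDBrane L) {x : M} {v : TangentSpace I x}
    (hv : v ∈ L x) : P.K x v ∈ L x := by
  rw [← hL.map_K x]
  exact Submodule.mem_map_of_mem hv

lemma IsAlmostBornDBrane.projPlus_mem (hL : P.IsAlmostBornDBrane L) {x : M}
    {v : TangentSpace I x} (hv : v ∈ L x) : P.projPlus x v ∈ L x :=
  (L x).smul_mem _ ((L x).add_mem hv (hL.K_mem hv))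

lemma IsAlmostBornDBrane.projMinus_mem (hL : P.IsAlmostBornDBrane L) {x : M}
    {v : TangentSpace I x} (hv : v ∈ L x) : P.projMinus x v ∈ L x :=
  (L x).smul_mem _ ((L x).sub_mem hv (hL.K_mem hv))

variable [FiniteDimensional ℝ E] [T2Space M]

lemma contMDiff_canonicalConnection {X Y : Π x : M, TangentSpace I x}
    (hX : CMDiff ∞ (T% X)) (hY : CMDiff ∞ (T% Y)) :
    CMDiff ∞ (T% (fun x ↦ P.canonicalConnection Y x (X x))) :=
  (P.contMDiff_projPlus (P.η.contMDiff_leviCivita hX (P.contMDiff_projPlus hY))).add_section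
    (P.contMDiff_projMinus (P.η.contMDiff_leviCivita hX (P.contMDiff_projMinus hY)))

/-- If the Levi-Civita connection preserves an almost Born D-brane, so does the canonical
connection. -/
lemma IsAlmostBornDBrane.canonicalConnection_mem (hL : P.IsAlmostBornDBrane L)
    (hLC : IsPreservedBy P.η.leviCivita L) {Y : Π x : M, TangentSpace I x}
    (hY : IsSection L Y) {x : M} (v : TangentSpace I x) :
    P.canonicalConnection Y x v ∈ L x := by
  obtain ⟨X, hX, rfl⟩ := exists_contMDiff_eq v
  exact (L x).add_mem
    (hL.projPlus_mem (hLC X _ hX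
      ⟨P.contMDiff_projPlus hY.1, fun y ↦ hL.projPlus_mem (hY.2 y)⟩ x))
    (hL.projMinus_mem (hLC X _ hX
      ⟨P.contMDiff_projMinus hY.1, fun y ↦ hL.projMinus_mem (hY.2 y)⟩ x))

/-- On sections of an almost Born D-brane preserved by the Levi-Civita connection, the term
`η(∇ᶜ_Z X, Y)` of the canonical bracket vanishes by isotropy. -/
lemma IsAlmostBornDBrane.canonicalBracket_eq (hL : P.IsAlmostBornDBrane L)
    (hLC : IsPreservedBy P.η.leviCivita L) {X Y : Π x : M, TangentSpace I x}
    (hX : IsSection L X) (hY : IsSection L Y) :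
    P.canonicalBracket X Y = fun x ↦
      P.canonicalConnection Y x (X x) - P.canonicalConnection X x (Y x) := by
  ext x
  refine P.η.eq_of_val_eq fun w ↦ ?_
  obtain ⟨Z, -, rfl⟩ := exists_contMDiff_eq w
  rw [canonicalBracket, P.η.val_dBracket,
    (hL.maximal x).prop _ (hL.canonicalConnection_mem hLC hX (Z x)) _ (hY.2 x), add_zero]

end AlmostParaHermitian

/-- A distribution preserved by a torsion-free connection is involutive. -/
lemma IsPreservedBy.isInvolutive {E : Type*} [NormedAddCommGroup E] [NormedSpace ℝ E]
    [FiniteDimensional ℝ E] {H : Type*} [TopologicalSpace H] {I : ModelWithCorners ℝ E H}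
    {M : Type*} [TopologicalSpace M] [ChartedSpace H M] [IsManifold I ∞ M]
    {cov : CovariantDerivative I E (TangentSpace I : M → Type _)} (hcov : cov.torsion = 0)
    {L : ∀ x : M, Submodule ℝ (TangentSpace I x)} (hL : IsPreservedBy cov L) :
    IsInvolutive L := by
  refine fun X Y hX hY ↦ ⟨contMDiff_mlieBracket hX.1 hY.1, fun x ↦ ?_⟩
  rw [← (CovariantDerivative.torsion_eq_zero_iff _).1 hcov (hX.1.mdifferentiable (by simp) x)
    (hY.1.mdifferentiable (by simp) x)]
  exact (L x).sub_mem (hL X Y hX.1 hY x) (hL Y X hY.1 hX x)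

end ParaHermitian

theorem proposition3p1 {d : ℕ} {M : Type*} [TopologicalSpace M] [T2Space M]
    [SecondCountableTopology M] [ChartedSpace (EuclideanSpace ℝ (Fin (2 * d))) M]
    [IsManifold (𝓡 (2 * d)) ∞ M]
    (P : ParaHermitian.AlmostParaHermitian (𝓡 (2 * d)) M d)
    (L : ∀ x : M, Submodule ℝ (TangentSpace (𝓡 (2 * d)) x))
    (hL : P.IsAlmostBornDBrane L)
    (hLC : ParaHermitian.IsPreservedBy P.η.leviCivita L) :
    P.IsBornDBrane L ∧ P.IsDIntegrable L := by
  refine ⟨⟨hL, hLC.isInvolutive P.η.torsion_leviCivita⟩, fun X Y hX hY ↦ ?_⟩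
  rw [hL.canonicalBracket_eq hLC hX hY]
  exact ⟨(P.contMDiff_canonicalConnection hX.1 hY.1).sub_section
      (P.contMDiff_canonicalConnection hY.1 hX.1),
    fun x ↦ (L x).sub_mem (hL.canonicalConnection_mem hLC hY _)
      (hL.canonicalConnection_mem hLC hX _)⟩
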